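/- Let $n\ge 0$ and let $w=w_1\cdots w_n$ be a permutation of $[n]=\{1,\dots,n\}$ that avoids the pattern $321$, i.e. there are no $i<j<k$ with $w_i>w_j>w_k$. Let $\ell(u)$ denote the number of inversions of a permutation $u$ (pairs $i<j$ with $u_i>u_j$), let $\preceq$ be the strong Bruhat order on $S_n$ (generated by the covers $u\prec u\,t_{ij}$ for transpositions $t_{ij}$ with $\ell(u\,t_{ij})=\ell(u)+1$), and let $P_w(q)=\sum_{u\preceq w}q^{\ell(u)}$. Let $E_w=\{(i,w_j) : i<j,\ w_j<w_i\}\subseteq[n]\times[n]$, where $(r,c)$ denotes the cell in row $r$ and column $c$, rows being numbered from top to bottom and columns from left to right. A filling of $E_w$ is a map $f:E_w\to\{0,1\}$, and $|f|$ is its number of $1$s. Consider all rectangles $i<i'$, $j<j'$ whose four vertices $(i,j),(i,j'),(i',j),(i',j')$ all lie in $E_w$. The filling $f$ is an $\mathrm{L}$-filling if no such rectangle has $f(i',j)=0$ and $f(i,j)=f(i',j')=1$ (lower left vertex $0$, its two neighbours $1$). It is a rotated-$\mathrm{L}$-filling ($\mathrm{L}$ rotated by $180^\circ$) if no such rectangle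 has $f(i,j')=0$ and $f(i,j)=f(i',j')=1$ (upper right vertex $0$, its two neighbours $1$). Then, as Laurent polynomials in $q$, $$\sum_{f\ \mathrm{L}\text{-filling of }E_w} q^{|f|}\;=\;\sum_{f\ \text{rotated-}\mathrm{L}\text{-filling of }E_w} q^{|f|}\;=\;q^{\ell(w)}\,P_w(q^{-1}).$$ -/

import Mathlib

open Polynomial LaurentPolynomial

noncomputable section

namespace PermDiagram

/-- The length `ℓ(w)`: the number of inversions of `w`, i.e. of pairs `i < j` with `w i > w j`. -/
def length {n : ℕ} (w : Equiv.Perm (Fin n)) : ℕ :=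
  (Finset.univ.filter fun p : Fin n × Fin n => p.1 < p.2 ∧ w p.2 < w p.1).card

/-- `w` avoids the pattern `321`. -/
def Avoids321 {n : ℕ} (w : Equiv.Perm (Fin n)) : Prop :=
  ¬ ∃ i j k : Fin n, i < j ∧ j < k ∧ w k < w j ∧ w j < w i

/-- `v` covers `u` in the strong Bruhat order: `v = u · t_{ij}` and `ℓ(v) = ℓ(u) + 1`. -/
def BruhatCover {n : ℕ} (u v : Equiv.Perm (Fin n)) : Prop :=
  ∃ i j : Fin n, i ≠ j ∧ v = u * Equiv.swap i j ∧ length v = length u + 1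

/-- The strong Bruhat order `u ≼ v`, generated by the covers. -/
def BruhatLE {n : ℕ} (u v : Equiv.Perm (Fin n)) : Prop :=
  Relation.ReflTransGen BruhatCover u v

open scoped Classical in
/-- The Poincaré polynomial `P_w(q) = ∑_{u ≼ w} q^{ℓ(u)}`. -/
def poincare {n : ℕ} (w : Equiv.Perm (Fin n)) : ℤ[X] :=
  ∑ u : Equiv.Perm (Fin n) with BruhatLE u w, X ^ length u

/-- The south-east (Rothe) diagram `E_w`: the cells `(i, w j)` with `i < j` and `w j < w i`.
A cell is (row, column), rows numbered from top to bottom, columns from left to right. -/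
def seDiagram {n : ℕ} (w : Equiv.Perm (Fin n)) : Finset (Fin n × Fin n) :=
  Finset.univ.filter fun p => ∃ j : Fin n, p.1 < j ∧ w j < w p.1 ∧ p.2 = w j

/-- A filling of a diagram with `0`s and `1`s. -/
abbrev Filling {n : ℕ} (D : Finset (Fin n × Fin n)) : Type := D → Fin 2

/-- The number of `1`s of a filling. -/
def Filling.size {n : ℕ} {D : Finset (Fin n × Fin n)} (f : Filling D) : ℕ :=
  (Finset.univ.filter fun c : D => f c = 1).card

/-- `L`-fillings: no rectangle with all four vertices in `D` has a `0` in its lower left vertex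
and `1`s in its upper left and lower right vertices (the upper right vertex is arbitrary). -/
def Filling.IsL {n : ℕ} {D : Finset (Fin n × Fin n)} (f : Filling D) : Prop :=
  ∀ (i i' j j' : Fin n), i < i' → j < j' →
    ∀ (hul : (i, j) ∈ D) (_hur : (i, j') ∈ D) (hll : (i', j) ∈ D) (hlr : (i', j') ∈ D),
      ¬ (f ⟨(i', j), hll⟩ = 0 ∧ f ⟨(i, j), hul⟩ = 1 ∧ f ⟨(i', j'), hlr⟩ = 1)

/-- Fillings for `L` rotated by 180 degrees: no rectangle with all four vertices in `D` has a `0`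
in its upper right vertex and `1`s in its upper left and lower right vertices (the lower left
vertex is arbitrary). -/
def Filling.IsRotL {n : ℕ} {D : Finset (Fin n × Fin n)} (f : Filling D) : Prop :=
  ∀ (i i' j j' : Fin n), i < i' → j < j' →
    ∀ (hul : (i, j) ∈ D) (hur : (i, j') ∈ D) (_hll : (i', j) ∈ D) (hlr : (i', j') ∈ D),
      ¬ (f ⟨(i, j'), hur⟩ = 0 ∧ f ⟨(i, j), hul⟩ = 1 ∧ f ⟨(i', j'), hlr⟩ = 1)

open scoped Classical in
/-- The generating function of the `L`-fillings of `E_w` by number of `1`s. -/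
def genL {n : ℕ} (w : Equiv.Perm (Fin n)) : ℤ[X] :=
  ∑ f : Filling (seDiagram w) with f.IsL, X ^ f.size

open scoped Classical in
/-- The generating function of the rotated-`L`-fillings of `E_w` by number of `1`s. -/
def genRotL {n : ℕ} (w : Equiv.Perm (Fin n)) : ℤ[X] :=
  ∑ f : Filling (seDiagram w) with f.IsRotL, X ^ f.size

/-- The Laurent polynomial `q^{ℓ(w)} P_w(q⁻¹)`. -/
def reversedPoincare {n : ℕ} (w : Equiv.Perm (Fin n)) : ℤ[T;T⁻¹] :=
  LaurentPolynomial.T (length w : ℤ) * LaurentPolynomial.invert (Polynomial.toLaurent (poincare w))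

end PermDiagram

end

/-! The rotated case goes by induction on the largest non-fixed value `N` of `w`. Since `w` avoids
`321`, it increases to the right of `N`, so `N` can be moved to position `N` by adjacent swaps that
pass the values of `K = rowColumns w N` in increasing order; the result is `v`. By the lifting
property (`bruhatLE_mul_swap_iff`), undoing one such swap keeps exactly those elements of the lower
interval that ascend at the swapped positions, together with their products with the swap. Iterating
this, with `u` recorded as `u * w⁻¹`, the elements below `w` correspond to pairs `(x, B)` with `x ≼
v` and `B` a set of left-to-right maxima of `x * v⁻¹` on `K`; the codimension grows by `B.card`
(`exists_row_removal`).

With rows named by values, the diagram of `w` is that of `v` with a bottom row `N` added in the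
columns `K`. A rotated-`L` filling is one of `v` together with a set `B` of `1`s in row `N`, each in
a column permitted by the rows above (`IsRowRemoval.isRotSet_iff`).

The two recursions agree once one remembers which columns are permitted. `RecordData` does so for
permutations and `ColumnData` for fillings; both decide the admissible `B`, and both change by the
same rule `extendData` (`recordData_eq`, `columnData_eq`). Hence codimension and data on one side
are distributed like number of `1`s and data on the other.

The `L` case follows by transposing cells, which replaces `w` by `w⁻¹`; inversion preserves length
and Bruhat order. -/

namespace PermDiagram

/-! ### Strong Bruhat order and the lifting property -/

section Bruhat

variable {n : ℕ}

/-- The set of inversions of `w`, as pairs of positions. -/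
def inversions (w : Equiv.Perm (Fin n)) : Finset (Fin n × Fin n) :=
  Finset.univ.filter fun p => p.1 < p.2 ∧ w p.2 < w p.1

theorem length_eq_card_inversions (w : Equiv.Perm (Fin n)) :
    length w = (inversions w).card := rfl

theorem mem_inversions {w : Equiv.Perm (Fin n)} {a b : Fin n} :
    (a, b) ∈ inversions w ↔ a < b ∧ w b < w a := by
  simp [inversions]

/-- Inversions of `u` inject into those of the product other than `(i, j)`: move both positions by
the transposition if their order survives, and otherwise keep the pair, which is then still an
inversion. -/
theorem length_lt_length_mul_swap {u : Equiv.Perm (Fin n)} {i j : Fin n} (hij : i < j)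
    (h : u i < u j) : length u < length (u * Equiv.swap i j) := by
  have hmem : (i, j) ∈ inversions (u * Equiv.swap i j) := by
    rw [mem_inversions]
    simpa using ⟨hij, h⟩
  have hle : (inversions u).card ≤ ((inversions (u * Equiv.swap i j)).erase (i, j)).card := by
    refine Finset.card_le_card_of_injOn
      (fun p => if Equiv.swap i j p.1 < Equiv.swap i j p.2
        then (Equiv.swap i j p.1, Equiv.swap i j p.2) else p) ?_ ?_
    · rintro ⟨a, b⟩ hab
      rw [Finset.mem_coe, mem_inversions] at hab
      dsimp only
      rw [Finset.mem_coe, Finset.mem_erase]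
      split_ifs with hlt
      · refine ⟨?_, ?_⟩
        · intro heq
          rw [Prod.mk.injEq] at heq
          have ha : a = j := by
            rw [← Equiv.swap_apply_self i j a, heq.1, Equiv.swap_apply_left]
          have hb : b = i := by
            rw [← Equiv.swap_apply_self i j b, heq.2, Equiv.swap_apply_right]
          subst ha hb
          exact lt_asymm hij hab.1
        · rw [mem_inversions]
          simpa using ⟨hlt, hab.2⟩
      · refine ⟨?_, ?_⟩
        · intro heq
          rw [Prod.mk.injEq] at heq
          rw [heq.1, heq.2] at hab
          exact lt_asymm h hab.2
        · rw [mem_inversions]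
          refine ⟨hab.1, ?_⟩
          rw [Equiv.Perm.mul_apply, Equiv.Perm.mul_apply]
          have h1 := hab.1
          have h2 := hab.2
          rw [Equiv.swap_apply_def, Equiv.swap_apply_def] at hlt ⊢
          split_ifs at hlt ⊢ <;> grind
    · rintro ⟨a, b⟩ hab ⟨c, d⟩ hcd heq
      rw [Finset.mem_coe, mem_inversions] at hab hcd
      dsimp only at heq
      split_ifs at heq with h1 h2 h2
      · simpa using heq
      · rw [Prod.mk.injEq] at heq
        rw [← heq.1, ← heq.2] at h2
        simp [hab.1] at h2
      · rw [Prod.mk.injEq] at heq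
        rw [heq.1, heq.2] at h1
        simp [hcd.1] at h1
      · exact heq
  rw [Finset.card_erase_of_mem hmem] at hle
  have := Finset.card_pos.mpr ⟨_, hmem⟩
  rw [length_eq_card_inversions, length_eq_card_inversions]
  omega

/-- An adjacent swap of positions keeps the order within every pair other than `(k, l)`, so no other
inversion is gained. -/
theorem length_mul_swap_of_adjacent {u : Equiv.Perm (Fin n)} {k l : Fin n}
    (hkl : (k : ℕ) + 1 = l) (h : u k < u l) : length (u * Equiv.swap k l) = length u + 1 := by
  have hlt : k < l := by rw [Fin.lt_def]; omega
  have h1 := length_lt_length_mul_swap hlt h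
  have hmem : (k, l) ∈ inversions (u * Equiv.swap k l) := by
    rw [mem_inversions]
    simpa using ⟨hlt, h⟩
  have hle : ((inversions (u * Equiv.swap k l)).erase (k, l)).card ≤ (inversions u).card := by
    refine Finset.card_le_card_of_injOn
      (fun p => (Equiv.swap k l p.1, Equiv.swap k l p.2)) ?_ ?_
    · rintro ⟨a, b⟩ hab
      rw [Finset.mem_coe, Finset.mem_erase, mem_inversions] at hab
      rw [Finset.mem_coe, mem_inversions]
      refine ⟨?_, by simpa using hab.2.2⟩
      have h1 := hab.2.1
      have h2 : ¬ (a = k ∧ b = l) := fun h => hab.1 (by rw [h.1, h.2])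
      rw [Equiv.swap_apply_def, Equiv.swap_apply_def]
      rw [Fin.lt_def] at h1 ⊢
      simp only [Fin.ext_iff] at h2 ⊢
      split_ifs <;> omega
    · rintro ⟨a, b⟩ _ ⟨c, d⟩ _ heq
      simpa using heq
  rw [Finset.card_erase_of_mem hmem] at hle
  rw [length_eq_card_inversions, length_eq_card_inversions] at *
  omega

theorem length_mul_swap_of_adjacent_of_gt {u : Equiv.Perm (Fin n)} {k l : Fin n}
    (hkl : (k : ℕ) + 1 = l) (h : u l < u k) : length (u * Equiv.swap k l) + 1 = length u := by
  have := length_mul_swap_of_adjacent (u := u * Equiv.swap k l) hkl (by simpa using h)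
  rw [mul_assoc, Equiv.swap_mul_self, mul_one] at this
  exact this.symm

theorem BruhatCover.exists_lt {u v : Equiv.Perm (Fin n)} (h : BruhatCover u v) :
    ∃ i j : Fin n, i < j ∧ u i < u j ∧ v = u * Equiv.swap i j ∧
      ∀ a, i < a → a < j → ¬ (u i < u a ∧ u a < u j) := by
  obtain ⟨i, j, hij, hv, hl⟩ := h
  wlog hlt : i < j generalizing i j
  · exact this j i hij.symm (by rw [Equiv.swap_comm, hv]) (lt_of_le_of_ne (not_lt.mp hlt) hij.symm)
  have hu : u i < u j := by
    by_contra hcon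
    have hne : u j ≠ u i := fun h => hij (u.injective h).symm
    have hgt : u j < u i := lt_of_le_of_ne (not_lt.mp hcon) hne
    have := length_lt_length_mul_swap (u := v) hlt (by simpa [hv] using hgt)
    rw [hv, mul_assoc, Equiv.swap_mul_self, mul_one, ← hv] at this
    omega
  refine ⟨i, j, hlt, hu, hv, ?_⟩
  rintro a hia haj ⟨h1, h2⟩
  -- An intermediate value at `a` factors `swap i j` as `swap i a * swap i j * swap a j`, with the
  -- length rising at each factor: at least three in total, against the one of a cover.
  have e1 := length_lt_length_mul_swap hia h1
  have e2 := length_lt_length_mul_swap (u := u * Equiv.swap i a) hlt (by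
    rw [Equiv.Perm.mul_apply, Equiv.Perm.mul_apply, Equiv.swap_apply_left,
      Equiv.swap_apply_of_ne_of_ne hij.symm haj.ne']
    exact h2)
  have e3 := length_lt_length_mul_swap (u := u * Equiv.swap i a * Equiv.swap i j) haj (by
    simp only [Equiv.Perm.mul_apply, Equiv.swap_apply_right,
      Equiv.swap_apply_of_ne_of_ne hia.ne' haj.ne, Equiv.swap_apply_left]
    exact h1)
  have e4 : u * Equiv.swap i a * Equiv.swap i j * Equiv.swap a j = v := by
    rw [hv]
    ext b
    simp only [Equiv.Perm.mul_apply]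
    congr 2
    simp only [Equiv.swap_apply_def]
    grind
  rw [e4] at e3
  omega

theorem BruhatLE.length_le {u v : Equiv.Perm (Fin n)} (h : BruhatLE u v) :
    length u ≤ length v := by
  induction h with
  | refl => exact le_rfl
  | tail _ hc ih =>
    obtain ⟨_, _, _, _, hl⟩ := hc
    omega

theorem bruhatCover_mul_swap {u : Equiv.Perm (Fin n)} {k l : Fin n}
    (hkl : (k : ℕ) + 1 = l) (h : u k < u l) : BruhatCover u (u * Equiv.swap k l) :=
  ⟨k, l, fun h => by subst h; omega, rfl, length_mul_swap_of_adjacent hkl h⟩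

theorem bruhatCover_mul_swap_of_gt {u : Equiv.Perm (Fin n)} {k l : Fin n}
    (hkl : (k : ℕ) + 1 = l) (h : u l < u k) : BruhatCover (u * Equiv.swap k l) u := by
  have := bruhatCover_mul_swap (u := u * Equiv.swap k l) hkl (by simpa using h)
  rwa [mul_assoc, Equiv.swap_mul_self, mul_one] at this

theorem BruhatCover.mul_right {u v s : Equiv.Perm (Fin n)} (h : BruhatCover u v)
    (hl : length (v * s) = length (u * s) + 1) : BruhatCover (u * s) (v * s) := by
  obtain ⟨i, j, hij, hv, -⟩ := h
  refine ⟨s⁻¹ i, s⁻¹ j, fun h => hij (s⁻¹.injective h), ?_, hl⟩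
  rw [hv, mul_assoc, Equiv.swap_mul_eq_mul_swap, mul_assoc]

/-- The smaller of `u` and `u * swap k l`, for adjacent positions `k`, `l`. -/
def lower (k l : Fin n) (u : Equiv.Perm (Fin n)) : Equiv.Perm (Fin n) :=
  if u k < u l then u else u * Equiv.swap k l

/-- The larger of `u` and `u * swap k l`, for adjacent positions `k`, `l`. -/
def upper (k l : Fin n) (u : Equiv.Perm (Fin n)) : Equiv.Perm (Fin n) :=
  if u k < u l then u * Equiv.swap k l else u

/-- If the cover moved only one of the positions `k`, `l` and still reversed their order, the other
one would carry a value strictly between the two exchanged values. -/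
theorem BruhatCover.eq_mul_swap {u v : Equiv.Perm (Fin n)} (h : BruhatCover u v) {k l : Fin n}
    (hkl : (k : ℕ) + 1 = l) (hu : u k < u l) (hv : v l < v k) : v = u * Equiv.swap k l := by
  obtain ⟨i, j, hij, huij, rfl, hno⟩ := h.exists_lt
  have h1 := hno k
  have h2 := hno l
  suffices i = k ∧ j = l by rw [this.1, this.2]
  have hkl' : k < l := by rw [Fin.lt_def]; omega
  rw [Equiv.Perm.mul_apply, Equiv.Perm.mul_apply, Equiv.swap_apply_def, Equiv.swap_apply_def] at hv
  have key : ∀ a : Fin n, a ≤ k ∨ l ≤ a := fun a => by simp only [Fin.le_def]; omega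
  have := key i
  have := key j
  grind

/-- If `u` and `v` both ascend or both descend at `k`, `l`, the swap shifts both lengths equally and
the cover is carried along. If only `u` ascends, then `v` is `u` times the swap. If only `v`
ascends, chains through `u` and `v` suffice. -/
theorem BruhatCover.lower_upper {u v : Equiv.Perm (Fin n)} (h : BruhatCover u v) {k l : Fin n}
    (hkl : (k : ℕ) + 1 = l) :
    BruhatLE (lower k l u) (lower k l v) ∧ BruhatLE (upper k l u) (upper k l v) := by
  have hne : k ≠ l := fun h => by subst h; omega
  have hl : length v = length u + 1 := by obtain ⟨_, _, _, _, hl⟩ := h; exact hl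
  unfold lower upper
  have gt_of : ∀ x : Equiv.Perm (Fin n), ¬ x k < x l → x l < x k := fun x hx =>
    lt_of_le_of_ne (not_lt.mp hx) (fun e => hne (x.injective e).symm)
  by_cases hu : u k < u l <;> by_cases hv : v k < v l
  · have e1 := length_mul_swap_of_adjacent hkl hu
    have e2 := length_mul_swap_of_adjacent hkl hv
    simp only [hu, hv, if_true]
    exact ⟨.single h, .single (h.mul_right (by omega))⟩
  · simp only [hu, hv, if_true, if_false]
    have := h.eq_mul_swap hkl hu (gt_of v hv)
    rw [this, mul_assoc, Equiv.swap_mul_self, mul_one]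
    exact ⟨.refl, .refl⟩
  · simp only [hu, hv, if_true, if_false]
    exact ⟨.head (bruhatCover_mul_swap_of_gt hkl (gt_of u hu)) (.single h),
      .tail (.single h) (bruhatCover_mul_swap hkl hv)⟩
  · have e1 := length_mul_swap_of_adjacent_of_gt hkl (gt_of u hu)
    have e2 := length_mul_swap_of_adjacent_of_gt hkl (gt_of v hv)
    simp only [hu, hv, if_false]
    exact ⟨.single (h.mul_right (by omega)), .single h⟩

theorem BruhatLE.lower_upper {u v : Equiv.Perm (Fin n)} (h : BruhatLE u v) {k l : Fin n}
    (hkl : (k : ℕ) + 1 = l) :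
    BruhatLE (lower k l u) (lower k l v) ∧ BruhatLE (upper k l u) (upper k l v) := by
  induction h with
  | refl => exact ⟨.refl, .refl⟩
  | tail _ hc ih =>
    have := hc.lower_upper hkl
    exact ⟨.trans ih.1 this.1, .trans ih.2 this.2⟩

/-- The lower interval of `v * swap k l`, where `v k < v l` and `k`, `l` are adjacent. -/
theorem bruhatLE_mul_swap_iff {v u : Equiv.Perm (Fin n)} {k l : Fin n}
    (hkl : (k : ℕ) + 1 = l) (hv : v k < v l) :
    BruhatLE u (v * Equiv.swap k l) ↔ BruhatLE (lower k l u) v := by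
  have hv' : ¬ (v * Equiv.swap k l) k < (v * Equiv.swap k l) l := by simpa using hv.le
  constructor
  · intro h
    have := (h.lower_upper hkl).1
    rwa [lower.eq_def k l (v * _), if_neg hv', mul_assoc, Equiv.swap_mul_self, mul_one] at this
  · intro h
    have := (h.lower_upper hkl).2
    rw [upper.eq_def k l v, if_pos hv] at this
    refine .trans ?_ this
    unfold lower upper
    by_cases hu : u k < u l
    · simp only [hu, if_true]
      exact .single (bruhatCover_mul_swap hkl hu)
    · have hu' : (u * Equiv.swap k l) k < (u * Equiv.swap k l) l := by
        have hne : k ≠ l := fun h => by subst h; omega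
        simpa using lt_of_le_of_ne (not_lt.mp hu) (fun e => hne (u.injective e).symm)
      simp only [hu, hu', if_false, if_true]
      rw [mul_assoc, Equiv.swap_mul_self, mul_one]

open scoped Classical in
/-- A sum over the lower interval of `v * swap k l`, where `v k < v l`, in terms of `v`. -/
theorem sum_bruhatLE_mul_swap {M : Type*} [AddCommMonoid M] {v : Equiv.Perm (Fin n)} {k l : Fin n}
    (hkl : (k : ℕ) + 1 = l) (hv : v k < v l) (F : Equiv.Perm (Fin n) → M) :
    ∑ u : Equiv.Perm (Fin n) with BruhatLE u (v * Equiv.swap k l), F u =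
      ∑ u : Equiv.Perm (Fin n) with BruhatLE u v,
        if u k < u l then F u + F (u * Equiv.swap k l) else 0 := by
  have hne : k ≠ l := fun h => by subst h; omega
  rw [← Finset.sum_filter, Finset.sum_add_distrib, Finset.filter_filter,
    ← Finset.sum_filter_add_sum_filter_not _ (fun u => u k < u l), Finset.filter_filter,
    Finset.filter_filter]
  congr 1
  · refine Finset.sum_congr (Finset.filter_congr fun u _ => ?_) fun _ _ => rfl
    rw [bruhatLE_mul_swap_iff hkl hv]
    refine and_congr_left fun h => ?_
    rw [lower, if_pos h]
  · refine Finset.sum_bij' (fun u _ => u * Equiv.swap k l) (fun u _ => u * Equiv.swap k l)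
      ?_ ?_ ?_ ?_ ?_
    · intro u hu
      simp only [Finset.mem_filter, Finset.mem_univ, true_and, bruhatLE_mul_swap_iff hkl hv] at hu ⊢
      refine ⟨?_, ?_⟩
      · simpa only [lower, if_neg hu.2] using hu.1
      · simpa using lt_of_le_of_ne (not_lt.mp hu.2) (fun e => hne (u.injective e).symm)
    · intro u hu
      simp only [Finset.mem_filter, Finset.mem_univ, true_and, bruhatLE_mul_swap_iff hkl hv] at hu ⊢
      have h2 : ¬ (u * Equiv.swap k l) k < (u * Equiv.swap k l) l := by simpa using hu.2.le
      refine ⟨?_, h2⟩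
      rw [lower, if_neg h2, mul_assoc, Equiv.swap_mul_self, mul_one]
      exact hu.1
    · intro u _
      rw [mul_assoc, Equiv.swap_mul_self, mul_one]
    · intro u _
      rw [mul_assoc, Equiv.swap_mul_self, mul_one]
    · intro u _
      rw [mul_assoc, Equiv.swap_mul_self, mul_one]

/-- Going down a cover exchanges the values at some `i < j`. If `j` were in the fixed range, the
larger value `a j` would be a fixed point of the upper permutation, forcing `a j = i`, although `a j
> a i = j`. -/
theorem BruhatLE.apply_eq_of_forall_ge {u v : Equiv.Perm (Fin n)} (h : BruhatLE u v) {N : ℕ}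
    (hv : ∀ j : Fin n, N ≤ j → v j = j) : ∀ j : Fin n, N ≤ j → u j = j := by
  induction h using Relation.ReflTransGen.head_induction_on with
  | refl => exact hv
  | head hc _ ih =>
    rename_i a c _
    obtain ⟨i, j, hij, hu, rfl, -⟩ := hc.exists_lt
    have hjN : ¬ N ≤ j := by
      intro hN
      have e1 := ih j hN
      rw [Equiv.Perm.mul_apply, Equiv.swap_apply_right] at e1
      rw [e1] at hu
      have e2 := ih (a j) (hN.trans hu.le)
      have e3 : (a * Equiv.swap i j) i = a j := by simp
      have := (a * Equiv.swap i j).injective (e2.trans e3.symm)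
      rw [this] at hu
      exact lt_asymm hu hij
    intro p hp
    have := ih p hp
    rwa [Equiv.Perm.mul_apply, Equiv.swap_apply_of_ne_of_ne] at this
    · rintro rfl; rw [Fin.lt_def] at hij; omega
    · rintro rfl; exact hjN hp

end Bruhat

/-! ### Moving the largest non-fixed value into place -/

section Row

variable {n : ℕ}

theorem apply_inv_self {α : Type*} (w : Equiv.Perm α) (a : α) : w (w⁻¹ a) = a :=
  Equiv.apply_symm_apply w a

theorem inv_apply_self {α : Type*} (w : Equiv.Perm α) (a : α) : w⁻¹ (w a) = a :=
  Equiv.symm_apply_apply w a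

/-- The cycle `b₁ ↦ b₂ ↦ ⋯ ↦ bᵣ ↦ N ↦ b₁`, where `b₁ < ⋯ < bᵣ` are the elements of `B`. -/
def rowCycle (N : Fin n) (B : Finset (Fin n)) : Equiv.Perm (Fin n) :=
  (B.sort (· ≤ ·)).foldr (fun a p => p * Equiv.swap a N) 1

@[simp]
theorem rowCycle_empty (N : Fin n) : rowCycle N ∅ = 1 := by
  simp [rowCycle]

theorem rowCycle_insert (N : Fin n) {B : Finset (Fin n)} {a : Fin n} (h : ∀ b ∈ B, a < b) :
    rowCycle N (insert a B) = rowCycle N B * Equiv.swap a N := by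
  rw [rowCycle, Finset.sort_insert (r := (· ≤ ·)) (fun b hb => (h b hb).le)
    (fun ha => lt_irrefl _ (h a ha))]
  rfl

theorem rowCycle_apply_of_notMem {N : Fin n} {B : Finset (Fin n)} {b : Fin n} (hb : b ∉ B)
    (hN : b ≠ N) : rowCycle N B b = b := by
  induction B using Finset.induction_on_min with
  | empty => simp
  | insert a B h ih =>
    rw [Finset.mem_insert, not_or] at hb
    rw [rowCycle_insert N h, Equiv.Perm.mul_apply, Equiv.swap_apply_of_ne_of_ne hb.1 hN, ih hb.2]

theorem rowCycle_apply_top {N : Fin n} {B : Finset (Fin n)} (hB : ∀ b ∈ B, b < N) :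
    rowCycle N B N ∈ insert N B ∧ ∀ b ∈ B, rowCycle N B N ≤ b := by
  induction B using Finset.induction_on_min with
  | empty => simp
  | insert a B h ih =>
    have haB : a ∉ B := fun ha => lt_irrefl _ (h a ha)
    rw [rowCycle_insert N h, Equiv.Perm.mul_apply, Equiv.swap_apply_right,
      rowCycle_apply_of_notMem haB (hB a (Finset.mem_insert_self a B)).ne]
    refine ⟨by simp, fun b hb => ?_⟩
    rcases Finset.mem_insert.mp hb with rfl | hb
    · exact le_rfl
    · exact (h b hb).le

theorem rowCycle_apply_of_mem {N : Fin n} {B : Finset (Fin n)} (hB : ∀ b ∈ B, b < N)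
    {b : Fin n} (hb : b ∈ B) :
    rowCycle N B b ∈ insert N B ∧ b < rowCycle N B b ∧ ∀ c ∈ B, b < c → rowCycle N B b ≤ c := by
  induction B using Finset.induction_on_min with
  | empty => simp at hb
  | insert a B h ih =>
    have hB' : ∀ b ∈ B, b < N := fun b hb => hB b (Finset.mem_insert_of_mem hb)
    have haN := hB a (Finset.mem_insert_self a B)
    rw [rowCycle_insert N h, Equiv.Perm.mul_apply]
    rcases Finset.mem_insert.mp hb with rfl | hbB
    · rw [Equiv.swap_apply_left]
      have := rowCycle_apply_top hB'
      refine ⟨?_, ?_, ?_⟩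
      · exact Finset.insert_subset_insert _ (Finset.subset_insert _ _) this.1
      · rcases Finset.mem_insert.mp this.1 with h1 | h1
        · rwa [h1]
        · exact h _ h1
      · intro c hc hbc
        exact this.2 c ((Finset.mem_insert.mp hc).resolve_left hbc.ne')
    · rw [Equiv.swap_apply_of_ne_of_ne (h b hbB).ne' (hB' b hbB).ne]
      have := ih hB' hbB
      refine ⟨Finset.insert_subset_insert _ (Finset.subset_insert _ _) this.1, this.2.1, ?_⟩
      intro c hc hbc
      rcases Finset.mem_insert.mp hc with rfl | hc
      · exact absurd hbc (h b hbB).asymm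
      · exact this.2.2 c hc hbc

/-- The values smaller than `N` to the right of `N` in `w`. -/
def rowColumns (w : Equiv.Perm (Fin n)) (N : Fin n) : Finset (Fin n) :=
  Finset.univ.filter fun b => b < N ∧ w⁻¹ N < w⁻¹ b

theorem mem_rowColumns {w : Equiv.Perm (Fin n)} {N b : Fin n} :
    b ∈ rowColumns w N ↔ b < N ∧ w⁻¹ N < w⁻¹ b := by
  simp [rowColumns]

/-- Every element of `B` is a left-to-right maximum of `y` restricted to `K`. -/
def AreRecords (y : Equiv.Perm (Fin n)) (K B : Finset (Fin n)) : Prop :=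
  ∀ b ∈ B, ∀ c ∈ K, c < b → y c < y b

theorem apply_lt_of_forall_ge {y : Equiv.Perm (Fin n)} {N : Fin n} (hy : ∀ j, N ≤ j → y j = j)
    {c : Fin n} (hc : c < N) : y c < N := by
  by_contra h
  have := y.injective (hy (y c) (not_lt.mp h))
  rw [this] at h
  exact h hc

theorem inv_apply_of_forall_ge {v : Equiv.Perm (Fin n)} {N : Fin n} (hv : ∀ j, N ≤ j → v j = j) :
    ∀ j, N ≤ j → v⁻¹ j = j := fun j hj => by
  rw [Equiv.Perm.inv_eq_iff_eq, hv j hj]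

/-- The cycle sends `N` to the least element of `B`, or to `N` if `B` is empty. As `y` increases
along records, comparing `y a` with this one value handles all of `B`. The new condition is the
ascent condition of the lifting property. -/
theorem areRecords_insert_iff {y : Equiv.Perm (Fin n)} {N : Fin n} (hy : ∀ j, N ≤ j → y j = j)
    {K B : Finset (Fin n)} {a : Fin n} (haN : a < N) (haK : ∀ b ∈ K, a < b)
    (hK : ∀ b ∈ K, b < N) (hB : B ⊆ K) :
    AreRecords y (insert a K) B ↔
      AreRecords y K B ∧ (y * rowCycle N B) a < (y * rowCycle N B) N := by
  have hBN : ∀ b ∈ B, b < N := fun b hb => hK b (hB hb)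
  have haB : a ∉ B := fun ha => lt_irrefl _ (haK a (hB ha))
  rw [Equiv.Perm.mul_apply, Equiv.Perm.mul_apply, rowCycle_apply_of_notMem haB haN.ne]
  obtain ⟨h1, h2⟩ := rowCycle_apply_top hBN
  constructor
  · intro h
    refine ⟨fun b hb c hc => h b hb c (Finset.mem_insert_of_mem hc), ?_⟩
    rcases Finset.mem_insert.mp h1 with h3 | h3
    · rw [h3, hy N le_rfl]
      exact apply_lt_of_forall_ge hy haN
    · exact h _ h3 a (Finset.mem_insert_self _ _) (haK _ (hB h3))
  · rintro ⟨h, hlt⟩ b hb c hc hcb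
    rcases Finset.mem_insert.mp hc with rfl | hc
    · refine hlt.trans_le ?_
      rcases (h2 b hb).eq_or_lt with h3 | h3
      · rw [h3]
      · rcases Finset.mem_insert.mp h1 with h4 | h4
        · rw [h4] at h3
          exact absurd h3 (hBN b hb).asymm
        · exact (h b hb _ (hB h4) h3).le
    · exact h b hb c hc hcb

open scoped Classical in
theorem sum_powerset_insert_areRecords {M : Type*} [AddCommMonoid M] {y : Equiv.Perm (Fin n)}
    {N : Fin n} (hy : ∀ j, N ≤ j → y j = j) {K : Finset (Fin n)} {a : Fin n} (haN : a < N)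
    (haK : ∀ b ∈ K, a < b) (hK : ∀ b ∈ K, b < N) (F : ℕ → Equiv.Perm (Fin n) → M) (d : ℕ) :
    ∑ B ∈ (insert a K).powerset with AreRecords y (insert a K) B,
        F (d + B.card) (y * rowCycle N B) =
      ∑ B ∈ K.powerset with AreRecords y K B,
        if (y * rowCycle N B) a < (y * rowCycle N B) N then
          F (d + B.card) (y * rowCycle N B) +
            F (d + B.card + 1) (y * rowCycle N B * Equiv.swap a N) else 0 := by
  have haK' : a ∉ K := fun ha => lt_irrefl _ (haK a ha)
  rw [Finset.sum_filter, Finset.sum_powerset_insert haK', ← Finset.sum_add_distrib,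
    Finset.sum_filter]
  refine Finset.sum_congr rfl fun B hB => ?_
  rw [Finset.mem_powerset] at hB
  -- The smallest argument is always a left-to-right maximum.
  have h1 : AreRecords y (insert a K) (insert a B) ↔ AreRecords y (insert a K) B := by
    constructor
    · exact fun h b hb => h b (Finset.mem_insert_of_mem hb)
    · intro h b hb c hc hcb
      rcases Finset.mem_insert.mp hb with rfl | hb
      · rcases Finset.mem_insert.mp hc with rfl | hc
        · exact absurd hcb (lt_irrefl _)
        · exact absurd hcb (haK c hc).asymm
      · exact h b hb c hc hcb
  have haB : a ∉ B := fun ha => haK' (hB ha)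
  rw [if_congr h1 rfl rfl, Finset.card_insert_of_notMem haB,
    rowCycle_insert N fun b hb => haK b (hB hb), ← mul_assoc, ← add_assoc]
  have h2 := areRecords_insert_iff hy haN haK hK hB
  by_cases h3 : AreRecords y K B <;>
    by_cases h4 : (y * rowCycle N B) a < (y * rowCycle N B) N <;>
    simp [h2, h3, h4, -Equiv.Perm.coe_mul]

open scoped Classical in
/-- Moving the largest non-fixed value `N` of `w` to position `N` turns `w` into a permutation `v`
whose lower Bruhat interval determines that of `w`. -/
theorem exists_row_removal (N : Fin n) (w : Equiv.Perm (Fin n)) (hfix : ∀ j, N < j → w j = j)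
    (hinc : ∀ p q, w⁻¹ N < p → p < q → w p < w q) :
    ∃ v : Equiv.Perm (Fin n), (∀ j, N ≤ j → v j = j) ∧
      (∀ a b, a < N → b < N → (v⁻¹ a < v⁻¹ b ↔ w⁻¹ a < w⁻¹ b)) ∧
      ∀ {M : Type} [AddCommMonoid M] (F : ℕ → Equiv.Perm (Fin n) → M),
        ∑ u : Equiv.Perm (Fin n) with BruhatLE u w, F (length w - length u) (u * w⁻¹) =
          ∑ x : Equiv.Perm (Fin n) with BruhatLE x v,
            ∑ B ∈ (rowColumns w N).powerset with AreRecords (x * v⁻¹) (rowColumns w N) B,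
              F (length v - length x + B.card) (x * v⁻¹ * rowCycle N B) := by
  -- Induction on the number of places that `N` still has to move right.
  obtain ⟨m, hm⟩ : ∃ m, (N : ℕ) - (w⁻¹ N : Fin n) = m := ⟨_, rfl⟩
  induction m generalizing w with
  | zero =>
    have hN : w⁻¹ N = N := by
      rcases (show N ≤ w⁻¹ N by rw [Fin.le_def]; omega).eq_or_lt with h | h
      · exact h.symm
      · have := hfix _ h
        rw [apply_inv_self] at this
        exact this.symm
    have hfix' : ∀ j, N ≤ j → w j = j := by
      intro j hj
      rcases hj.eq_or_lt with rfl | hj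
      · rw [← Equiv.Perm.eq_inv_iff_eq, hN]
      · exact hfix j hj
    have hK : rowColumns w N = ∅ := by
      refine Finset.eq_empty_of_forall_notMem fun b hb => ?_
      rw [mem_rowColumns, hN] at hb
      have := hfix _ hb.2
      rw [apply_inv_self] at this
      rw [← this] at hb
      exact lt_asymm hb.1 hb.2
    refine ⟨w, hfix', fun _ _ _ _ => Iff.rfl, fun F => ?_⟩
    refine Finset.sum_congr rfl fun u _ => ?_
    rw [hK, Finset.powerset_empty, Finset.filter_singleton, if_pos (by simp [AreRecords])]
    simp
  | succ m ih =>
    set i := w⁻¹ N with hi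
    have hwi : w i = N := by rw [hi, apply_inv_self]
    have hiN : (i : ℕ) < N := by omega
    obtain ⟨l, hl⟩ : ∃ l : Fin n, (i : ℕ) + 1 = l := ⟨⟨i + 1, by omega⟩, rfl⟩
    have hil : i < l := by rw [Fin.lt_def]; omega
    have hlN : l ≤ N := by rw [Fin.le_def]; omega
    set a := w l with ha
    have haN : a < N := by
      rcases lt_trichotomy a N with h | h | h
      · exact h
      · rw [← hwi, ha] at h
        exact absurd (w.injective h) hil.ne'
      · have := w.injective (hfix a h)
        rw [this] at h
        exact absurd hlN (not_le.mpr h)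
    set w' := w * Equiv.swap i l with hw'
    have hww' : w = w' * Equiv.swap i l := by
      rw [hw', mul_assoc, Equiv.swap_mul_self, mul_one]
    have hinv : ∀ b, w'⁻¹ b = Equiv.swap i l (w⁻¹ b) := fun b => by
      rw [hw', mul_inv_rev, Equiv.swap_inv, Equiv.Perm.mul_apply]
    have hw'N : w'⁻¹ N = l := by rw [hinv, ← hi, Equiv.swap_apply_left]
    have hw'i : w' i = a := by rw [hw', Equiv.Perm.mul_apply, Equiv.swap_apply_left]
    have hw'l : w' l = N := by rw [hw', Equiv.Perm.mul_apply, Equiv.swap_apply_right, hwi]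
    have hw'p : ∀ p, l < p → w' p = w p := fun p hp => by
      rw [hw', Equiv.Perm.mul_apply, Equiv.swap_apply_of_ne_of_ne (hil.trans hp).ne' hp.ne']
    have hwa : w⁻¹ a = l := by rw [ha, inv_apply_self]
    obtain ⟨v, hv, hord, hsum⟩ := ih w' (fun j hj => by rw [hw'p j (hlN.trans_lt hj), hfix j hj])
      (fun p q hp hpq => by
        rw [hw'N] at hp
        rw [hw'p p hp, hw'p q (hp.trans hpq)]
        exact hinc p q (hil.trans hp) hpq)
      (by rw [hw'N]; omega)
    have hcol : rowColumns w N = insert a (rowColumns w' N) := by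
      ext b
      rw [Finset.mem_insert, mem_rowColumns, mem_rowColumns, hw'N, hinv, ← hi]
      by_cases hba : b = a
      · simp [hba, hwa, haN, hil]
      · by_cases hbN : b < N
        · have h1 : w⁻¹ b ≠ i := fun h => by
            rw [hi] at h; exact hbN.ne (w⁻¹.injective h)
          have h2 : w⁻¹ b ≠ l := fun h => by
            rw [← hwa] at h; exact hba (w⁻¹.injective h)
          rw [Equiv.swap_apply_of_ne_of_ne h1 h2]
          simp only [hba, hbN, true_and, false_or, Fin.lt_def]
          rw [Ne, Fin.ext_iff] at h2
          omega
        · simp [hba, hbN]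
    have haK : ∀ b ∈ rowColumns w' N, a < b := by
      intro b hb
      rw [mem_rowColumns, hw'N] at hb
      have h1 := hw'p _ hb.2
      rw [apply_inv_self] at h1
      rw [h1, ha]
      exact hinc _ _ hil hb.2
    refine ⟨v, hv, fun b c hb hc => ?_, fun F => ?_⟩
    · rw [hord b c hb hc, hinv, hinv]
      have h1 : ∀ d, d < N → w⁻¹ d ≠ i := fun d hd h => by
        rw [hi] at h; exact hd.ne (w⁻¹.injective h)
      have hb1 := h1 b hb
      have hc1 := h1 c hc
      rw [Equiv.swap_apply_def, Equiv.swap_apply_def, if_neg hb1, if_neg hc1]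
      simp only [Ne, Fin.ext_iff, Fin.lt_def] at hb1 hc1 ⊢
      split_ifs <;> omega
    · have hx : ∀ x ∈ Finset.univ.filter (BruhatLE · v), ∀ j, N ≤ j → (x * v⁻¹) j = j := by
        intro x hx j hj
        rw [Finset.mem_filter] at hx
        rw [Equiv.Perm.mul_apply, inv_apply_of_forall_ge hv j hj]
        exact hx.2.apply_eq_of_forall_ge (N := N) hv j hj
      rw [hcol, Finset.sum_congr rfl fun x h => sum_powerset_insert_areRecords (hx x h) haN haK
        (fun b hb => (mem_rowColumns.mp hb).1) F _]
      -- The induction hypothesis is used for the function that collects both contributions of a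
      -- pair `u`, `u * swap i l`.
      rw [← hsum fun d z => if z a < z N then F d z + F (d + 1) (z * Equiv.swap a N) else 0]
      have hlt : w' i < w' l := by rw [hw'i, hw'l]; exact haN
      have hlen : length w = length w' + 1 := by
        rw [hww']; exact length_mul_swap_of_adjacent hl hlt
      conv_lhs => rw [hww', sum_bruhatLE_mul_swap hl hlt, ← hww']
      refine Finset.sum_congr rfl fun u hu => ?_
      rw [Finset.mem_filter] at hu
      have hua : (u * w'⁻¹) a = u i := by
        rw [Equiv.Perm.mul_apply, ← hw'i, inv_apply_self]
      have huN : (u * w'⁻¹) N = u l := by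
        rw [Equiv.Perm.mul_apply, ← hw'l, inv_apply_self]
      rw [hua, huN]
      refine if_ctx_congr Iff.rfl (fun hui => ?_) fun _ => rfl
      -- The lower element `u` corresponds to adding `a` to `B`, with one more unit of codimension;
      -- the upper element `u * swap i l` leaves `B` and the codimension unchanged.
      have h1 : u * w'⁻¹ * Equiv.swap a N = u * w⁻¹ := by
        rw [← hw'i, ← hw'l, Equiv.swap_apply_apply, hww']
        simp [mul_assoc]
      have h2 : u * Equiv.swap i l * w⁻¹ = u * w'⁻¹ := by
        rw [hw', mul_inv_rev, Equiv.swap_inv, mul_assoc]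
      have h3 := hu.2.length_le
      have h4 := length_mul_swap_of_adjacent hl hui
      rw [h1, h2, h4, hlen, add_comm, Nat.add_sub_add_right, Nat.sub_add_comm h3]

end Row

/-! ### Matching Bruhat intervals with fillings row by row -/

section Diagram

variable {n : ℕ}

/-- The inversions of `w` as pairs of values, the larger one first. For a `321`-avoiding `w` this is
`seDiagram w` with row `i` renamed `w i`. -/
def valueDiagram (w : Equiv.Perm (Fin n)) : Finset (Fin n × Fin n) :=
  Finset.univ.filter fun p => p.2 < p.1 ∧ w⁻¹ p.1 < w⁻¹ p.2

theorem mem_valueDiagram {w : Equiv.Perm (Fin n)} {r b : Fin n} :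
    (r, b) ∈ valueDiagram w ↔ b < r ∧ w⁻¹ r < w⁻¹ b := by
  simp [valueDiagram]

/-- The rotated-`L` condition on the set `S` of cells of `D` filled with `1`. -/
def IsRotSet (D S : Finset (Fin n × Fin n)) : Prop :=
  ∀ r t b c, r < t → b < c → (r, b) ∈ D → (r, c) ∈ D → (t, b) ∈ D → (t, c) ∈ D →
    ¬ ((r, c) ∉ S ∧ (r, b) ∈ S ∧ (t, c) ∈ S)

/-- From the position of the value `b` on, `w` is increasing. -/
def InTail (w : Equiv.Perm (Fin n)) (b : Fin n) : Prop :=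
  ∀ p q, w⁻¹ b ≤ p → p < q → w p < w q

/-- `z` takes at `b` its largest value among the arguments in `[c, b]` that lie in the tail
of `w`. -/
def RecordData (w z : Equiv.Perm (Fin n)) (c b : Fin n) : Prop :=
  InTail w b ∧ ∀ a, InTail w a → c ≤ a → a < b → z a < z b

/-- In a row with a `0` in column `b`, all columns in `[c, b]` that lie in the tail of `w` have
a `0`. -/
def ColumnData (w : Equiv.Perm (Fin n)) (S : Finset (Fin n × Fin n)) (c b : Fin n) : Prop :=
  InTail w b ∧ ∀ a, InTail w a → c ≤ a → a < b →
    ∀ r, (r, a) ∈ valueDiagram w → (r, b) ∈ valueDiagram w → (r, b) ∉ S → (r, a) ∉ S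

/-- The effect on `RecordData` and `ColumnData` of adding the row `N` with columns `K` and
`1`s in the columns `B`, where `m` is the smallest element of `K`. -/
def extendData (N m : Fin n) (K B : Finset (Fin n)) (R : Fin n → Fin n → Prop) (c b : Fin n) :
    Prop :=
  (b ∈ K ∨ N < b) ∧ R (max c m) b ∧ (b ∈ K → b ∉ B → ∀ a ∈ K, c ≤ a → a < b → a ∉ B)

/-- The cycle gives each record the `y`-value of the next record, or of `N`, and fixes the other
elements of `K`. So a record still exceeds everything before it, while a non-record `b` is exceeded
by every record passed on its way. -/
theorem forall_lt_mul_rowCycle_iff {y : Equiv.Perm (Fin n)} {N : Fin n}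
    (hy : ∀ j, N ≤ j → y j = j) {K B : Finset (Fin n)} (hK : ∀ b ∈ K, b < N) (hB : B ⊆ K)
    (hrec : AreRecords y K B) {b : Fin n} (hb : b ∈ K) (c : Fin n) :
    (∀ a ∈ K, c ≤ a → a < b → (y * rowCycle N B) a < (y * rowCycle N B) b) ↔
      (∀ a ∈ K, c ≤ a → a < b → y a < y b) ∧ (b ∉ B → ∀ a ∈ K, c ≤ a → a < b → a ∉ B) := by
  have hBN : ∀ b ∈ B, b < N := fun b hb => hK b (hB hb)
  have hrec' : ∀ d ∈ insert N B, ∀ a ∈ K, a < d → y a < y d := by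
    intro d hd a ha had
    rcases Finset.mem_insert.mp hd with rfl | hd
    · rw [hy d le_rfl]
      exact apply_lt_of_forall_ge hy had
    · exact hrec d hd a ha had
  have hnot : ∀ a ∈ K, a ∉ B → (y * rowCycle N B) a = y a := fun a ha haB => by
    rw [Equiv.Perm.mul_apply, rowCycle_apply_of_notMem haB (hK a ha).ne]
  by_cases hbB : b ∈ B
  · obtain ⟨h1, h2, -⟩ := rowCycle_apply_of_mem hBN hbB
    refine iff_of_true ?_ ⟨fun a ha _ hab => hrec b hbB a ha hab, fun h => absurd hbB h⟩
    intro a ha _ hab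
    rw [Equiv.Perm.mul_apply y _ b]
    by_cases haB : a ∈ B
    · obtain ⟨h3, -, h5⟩ := rowCycle_apply_of_mem hBN haB
      have h6 := h5 b hbB hab
      rw [Equiv.Perm.mul_apply]
      rcases Finset.mem_insert.mp h3 with h7 | h7
      · rw [h7] at h6
        exact absurd (hBN b hbB) (not_lt.mpr h6)
      · exact hrec' _ h1 _ (hB h7) (h6.trans_lt h2)
    · rw [hnot a ha haB]
      exact hrec' _ h1 a ha (hab.trans h2)
  · rw [hnot b hb hbB]
    constructor
    · intro h
      have hno : ∀ a ∈ K, c ≤ a → a < b → a ∉ B := by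
        intro a _ hca hab haB
        have hne : (B.filter fun a => c ≤ a ∧ a < b).Nonempty :=
          ⟨a, Finset.mem_filter.mpr ⟨haB, hca, hab⟩⟩
        -- The last record `d` before `b` takes over the value of a record beyond `b`, which exceeds
        -- `y b`.
        obtain ⟨d, hd, hmax⟩ := Finset.exists_max_image _ id hne
        rw [Finset.mem_filter] at hd
        obtain ⟨h1, h2, -⟩ := rowCycle_apply_of_mem hBN hd.1
        have h4 := h d (hB hd.1) hd.2.1 hd.2.2
        rw [Equiv.Perm.mul_apply] at h4
        rcases lt_trichotomy b (rowCycle N B d) with h5 | h5 | h5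
        · exact lt_asymm h4 (hrec' _ h1 b hb h5)
        · rw [← h5] at h4
          exact lt_irrefl _ h4
        · rcases Finset.mem_insert.mp h1 with h6 | h6
          · rw [h6] at h5
            exact lt_asymm h5 (hK b hb)
          · exact absurd h2 (not_lt.mpr (hmax _ (Finset.mem_filter.mpr
              ⟨h6, hd.2.1.trans h2.le, h5⟩)))
      refine ⟨fun a ha hca hab => ?_, fun _ => hno⟩
      rw [← hnot a ha (hno a ha hca hab)]
      exact h a ha hca hab
    · rintro ⟨h1, h2⟩ a ha hca hab
      rw [hnot a ha (h2 hbB a ha hca hab)]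
      exact h1 a ha hca hab

/-- `v` arises from `w` by moving the largest non-fixed value `N` to position `N`, and `w` is
increasing to the right of `N`. -/
structure IsRowRemoval (N : Fin n) (w v : Equiv.Perm (Fin n)) : Prop where
  apply_w : ∀ j, N < j → w j = j
  apply_v : ∀ j, N ≤ j → v j = j
  order : ∀ a b, a < N → b < N → (v⁻¹ a < v⁻¹ b ↔ w⁻¹ a < w⁻¹ b)
  increasing : ∀ p q, w⁻¹ N < p → p < q → w p < w q
  nonempty : (rowColumns w N).Nonempty

namespace IsRowRemoval

variable {N : Fin n} {w v : Equiv.Perm (Fin n)}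

theorem inv_w (h : IsRowRemoval N w v) {j : Fin n} (hj : N < j) : w⁻¹ j = j := by
  rw [Equiv.Perm.inv_eq_iff_eq, h.apply_w j hj]

theorem inv_v (h : IsRowRemoval N w v) {j : Fin n} (hj : N ≤ j) : v⁻¹ j = j :=
  inv_apply_of_forall_ge h.apply_v j hj

theorem inv_top_lt (h : IsRowRemoval N w v) : w⁻¹ N < N := by
  obtain ⟨b, hb⟩ := h.nonempty
  rw [mem_rowColumns] at hb
  by_contra hcon
  have h1 := h.apply_w _ ((not_lt.mp hcon).trans_lt hb.2)
  rw [apply_inv_self] at h1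
  rw [← h1] at hb
  exact hcon (hb.2.trans hb.1)

/-- A smaller value follows `N` because `K` is nonempty, so the tail starts just to the right of
`N`. -/
theorem inTail_w_iff (h : IsRowRemoval N w v) {b : Fin n} :
    InTail w b ↔ b ∈ rowColumns w N ∨ N < b := by
  have key : InTail w b ↔ w⁻¹ N < w⁻¹ b := by
    constructor
    · intro hb
      by_contra hcon
      obtain ⟨c, hc⟩ := h.nonempty
      rw [mem_rowColumns] at hc
      have := hb _ _ (not_lt.mp hcon) hc.2
      rw [apply_inv_self, apply_inv_self] at this
      exact lt_asymm this hc.1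
    · exact fun hb p q hp hpq => h.increasing p q (hb.trans_le hp) hpq
  rw [key, mem_rowColumns]
  rcases lt_trichotomy b N with hb | rfl | hb
  · simp [hb, hb.asymm]
  · simp
  · simp only [hb, or_true, iff_true]
    rw [h.inv_w hb]
    exact h.inv_top_lt.trans hb

theorem inTail_v_of_ge (h : IsRowRemoval N w v) {b : Fin n} (hb : N ≤ b) : InTail v b := by
  intro p q hp hpq
  rw [h.inv_v hb] at hp
  rwa [h.apply_v p (hb.trans hp), h.apply_v q ((hb.trans hp).trans hpq.le)]

theorem inTail_v_of_mem (h : IsRowRemoval N w v) {b : Fin n} (hb : b ∈ rowColumns w N) :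
    InTail v b := by
  rw [mem_rowColumns] at hb
  intro p q hp hpq
  by_cases hq : N ≤ v q
  · have h1 : q = v q := by
      have := h.inv_v hq
      rwa [inv_apply_self] at this
    by_cases hvp : N ≤ v p
    · have h2 : p = v p := by
        have := h.inv_v hvp
        rwa [inv_apply_self] at this
      rwa [← h1, ← h2]
    · exact (not_le.mp hvp).trans_le hq
  · have hp' : v p < N := by
      by_contra hcon
      have h2 : p = v p := by
        have := h.inv_v (not_lt.mp hcon)
        rwa [inv_apply_self] at this
      have h3 : N ≤ q := (not_lt.mp hcon).trans (h2 ▸ hpq.le)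
      rw [h.apply_v q h3] at hq
      exact hq h3
    have h1 : w⁻¹ (v p) < w⁻¹ (v q) := by
      rw [← h.order _ _ hp' (not_le.mp hq), inv_apply_self, inv_apply_self]
      exact hpq
    have h2 : w⁻¹ b ≤ w⁻¹ (v p) := by
      by_contra hcon
      rw [not_le, ← h.order _ _ hp' hb.1, inv_apply_self] at hcon
      exact absurd hcon (not_lt.mpr hp)
    have := h.increasing _ _ (hb.2.trans_le h2) h1
    rwa [apply_inv_self, apply_inv_self] at this

/-- This is why a threshold `c` suffices in the data: `K` is cut out of the tail of `v` by its
minimum and `N`, so restricting to `K` means replacing `c` by `max c m`. -/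
theorem mem_rowColumns_iff (h : IsRowRemoval N w v) {a : Fin n} (haN : a < N) :
    a ∈ rowColumns w N ↔ InTail v a ∧ (rowColumns w N).min' h.nonempty ≤ a := by
  constructor
  · exact fun ha => ⟨h.inTail_v_of_mem ha, Finset.min'_le _ _ ha⟩
  · rintro ⟨h1, h2⟩
    have hm := mem_rowColumns.mp (Finset.min'_mem _ h.nonempty)
    set m := (rowColumns w N).min' h.nonempty
    rw [mem_rowColumns]
    refine ⟨haN, ?_⟩
    by_contra hcon
    have h3 : w⁻¹ a < w⁻¹ m := (not_lt.mp hcon).trans_lt hm.2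
    rw [← h.order _ _ haN hm.1] at h3
    have := h1 _ _ le_rfl h3
    rw [apply_inv_self, apply_inv_self] at this
    exact absurd this (not_lt.mpr h2)

theorem mem_valueDiagram_v (h : IsRowRemoval N w v) {r b : Fin n} :
    (r, b) ∈ valueDiagram v ↔ (r, b) ∈ valueDiagram w ∧ r < N := by
  rw [mem_valueDiagram, mem_valueDiagram]
  constructor
  · rintro ⟨h1, h2⟩
    have hr : r < N := by
      by_contra hcon
      rw [h.inv_v (not_lt.mp hcon)] at h2
      have := h.apply_v _ ((not_lt.mp hcon).trans h2.le)
      rw [apply_inv_self] at this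
      rw [← this] at h2
      exact lt_asymm h1 h2
    exact ⟨⟨h1, (h.order _ _ hr (h1.trans hr)).mp h2⟩, hr⟩
  · rintro ⟨⟨h1, h2⟩, hr⟩
    exact ⟨h1, (h.order _ _ hr (h1.trans hr)).mpr h2⟩

theorem mem_valueDiagram_w (h : IsRowRemoval N w v) {r b : Fin n} :
    (r, b) ∈ valueDiagram w ↔ (r, b) ∈ valueDiagram v ∨ (r = N ∧ b ∈ rowColumns w N) := by
  rw [h.mem_valueDiagram_v]
  rcases lt_trichotomy r N with hr | rfl | hr
  · simp [hr, hr.ne]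
  · simp [mem_valueDiagram, mem_rowColumns]
  · simp only [hr.asymm, hr.ne', and_false, false_and, or_false, iff_false]
    rw [mem_valueDiagram, h.inv_w hr]
    rintro ⟨h1, h2⟩
    have := h.apply_w _ (hr.trans h2)
    rw [apply_inv_self] at this
    rw [← this] at h2
    exact lt_asymm h1 h2

theorem recordData_min_iff (h : IsRowRemoval N w v) {y : Equiv.Perm (Fin n)} {b : Fin n}
    (hb : b ∈ rowColumns w N) (c : Fin n) :
    RecordData v y (max c ((rowColumns w N).min' h.nonempty)) b ↔
      ∀ a ∈ rowColumns w N, c ≤ a → a < b → y a < y b := by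
  have hbN := (mem_rowColumns.mp hb).1
  constructor
  · intro hR a ha hca hab
    have := (h.mem_rowColumns_iff (hab.trans hbN)).mp ha
    exact hR.2 a this.1 (max_le hca this.2) hab
  · intro hR
    refine ⟨h.inTail_v_of_mem hb, fun a ha hca hab => ?_⟩
    exact hR a ((h.mem_rowColumns_iff (hab.trans hbN)).mpr ⟨ha, (le_max_right _ _).trans hca⟩)
      ((le_max_left _ _).trans hca) hab

theorem columnData_min_iff (h : IsRowRemoval N w v) {S : Finset (Fin n × Fin n)} {b : Fin n}
    (hb : b ∈ rowColumns w N) (c : Fin n) :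
    ColumnData v S (max c ((rowColumns w N).min' h.nonempty)) b ↔
      ∀ a ∈ rowColumns w N, c ≤ a → a < b → ∀ r, (r, a) ∈ valueDiagram v →
        (r, b) ∈ valueDiagram v → (r, b) ∉ S → (r, a) ∉ S := by
  have hbN := (mem_rowColumns.mp hb).1
  constructor
  · intro hR a ha hca hab
    have := (h.mem_rowColumns_iff (hab.trans hbN)).mp ha
    exact hR.2 a this.1 (max_le hca this.2) hab
  · intro hR
    refine ⟨h.inTail_v_of_mem hb, fun a ha hca hab => ?_⟩
    exact hR a ((h.mem_rowColumns_iff (hab.trans hbN)).mpr ⟨ha, (le_max_right _ _).trans hca⟩)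
      ((le_max_left _ _).trans hca) hab

/-- For `b` in `K` this is `forall_lt_mul_rowCycle_iff`. Beyond `N` everything is fixed and both
sides hold; any other `b` lies outside the tail of `w`. -/
theorem recordData_eq (h : IsRowRemoval N w v) {y : Equiv.Perm (Fin n)}
    (hy : ∀ j, N ≤ j → y j = j) {B : Finset (Fin n)} (hB : B ⊆ rowColumns w N)
    (hrec : AreRecords y (rowColumns w N) B) :
    RecordData w (y * rowCycle N B) =
      extendData N ((rowColumns w N).min' h.nonempty) (rowColumns w N) B (RecordData v y) := by
  have hK : ∀ b ∈ rowColumns w N, b < N := fun b hb => (mem_rowColumns.mp hb).1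
  funext c b
  refine propext ?_
  by_cases hb : b ∈ rowColumns w N
  · rw [extendData, h.recordData_min_iff hb, RecordData, h.inTail_w_iff]
    simp only [hb, true_or, true_and, forall_const]
    rw [← forall_lt_mul_rowCycle_iff hy hK hB hrec hb c]
    refine forall_congr' fun a => ?_
    rw [h.inTail_w_iff]
    constructor
    · exact fun h1 ha => h1 (.inl ha)
    · intro h1 ha hca hab
      exact h1 (ha.resolve_right ((hab.trans (hK b hb)).asymm)) hca hab
  · by_cases hNb : N < b
    · have hz : ∀ j, b ≤ j → (y * rowCycle N B) j = j := fun j hj => by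
        have hNj := hNb.trans_le hj
        rw [Equiv.Perm.mul_apply, rowCycle_apply_of_notMem (fun hjB => hNj.asymm (hK j (hB hjB)))
          hNj.ne', hy j hNj.le]
      refine iff_of_true ⟨h.inTail_w_iff.mpr (.inr hNb), fun a _ _ hab => ?_⟩
        ⟨.inr hNb, ⟨h.inTail_v_of_ge hNb.le, fun a _ _ hab => ?_⟩, fun h => absurd h hb⟩
      · rw [hz b le_rfl]
        exact apply_lt_of_forall_ge hz hab
      · rw [hy b hNb.le]
        exact apply_lt_of_forall_ge (fun j hj => hy j (hNb.le.trans hj)) hab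
    · refine iff_of_false (fun hc => ?_) (fun hc => hc.1.elim hb hNb)
      exact (h.inTail_w_iff.mp hc.1).elim hb hNb

theorem notMem_of_subset (h : IsRowRemoval N w v) {S : Finset (Fin n × Fin n)}
    (hS : S ⊆ valueDiagram v) (b : Fin n) : (N, b) ∉ S := fun hb =>
  lt_irrefl _ (h.mem_valueDiagram_v.mp (hS hb)).2

/-- For `b` in `K`, rows of `v` give the old condition and row `N` gives the clause about `B`.
Columns beyond `N` contain no cells, so both sides hold there. -/
theorem columnData_eq (h : IsRowRemoval N w v) {S : Finset (Fin n × Fin n)}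
    (hS : S ⊆ valueDiagram v) {B : Finset (Fin n)} :
    ColumnData w (S ∪ {N} ×ˢ B) =
      extendData N ((rowColumns w N).min' h.nonempty) (rowColumns w N) B (ColumnData v S) := by
  have hK : ∀ b ∈ rowColumns w N, b < N := fun b hb => (mem_rowColumns.mp hb).1
  have hNS := h.notMem_of_subset hS
  have hrN : ∀ {r b}, (r, b) ∈ valueDiagram v → r ≠ N := fun hr =>
    (h.mem_valueDiagram_v.mp hr).2.ne
  funext c b
  refine propext ?_
  by_cases hb : b ∈ rowColumns w N
  · rw [extendData, h.columnData_min_iff hb, ColumnData, h.inTail_w_iff]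
    simp only [hb, true_or, true_and, forall_const]
    constructor
    · intro h1
      refine ⟨fun a ha hca hab r hra hrb hbS => ?_, fun hbB a ha hca hab haB => ?_⟩
      · have := h1 a (h.inTail_w_iff.mpr (.inl ha)) hca hab r (h.mem_valueDiagram_w.mpr (.inl hra))
          (h.mem_valueDiagram_w.mpr (.inl hrb)) (by simp [hbS, (hrN hrb).symm])
        exact fun haS => this (Finset.mem_union_left _ haS)
      · have := h1 a (h.inTail_w_iff.mpr (.inl ha)) hca hab N
          (h.mem_valueDiagram_w.mpr (.inr ⟨rfl, ha⟩)) (h.mem_valueDiagram_w.mpr (.inr ⟨rfl, hb⟩))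
          (by simp [hNS, hbB])
        exact this (by simp [haB])
    · rintro ⟨h1, h2⟩ a ha hca hab r hra hrb hbS
      have haK := (h.inTail_w_iff.mp ha).resolve_right ((hab.trans (hK b hb)).asymm)
      rcases h.mem_valueDiagram_w.mp hra with hra | ⟨rfl, -⟩
      · have hrN' := hrN hra
        have hrb := (h.mem_valueDiagram_w.mp hrb).resolve_right (fun hc => hrN' hc.1)
        have := h1 a haK hca hab r hra hrb (fun hc => hbS (Finset.mem_union_left _ hc))
        simp [this, hrN'.symm]
      · have := h2 (fun hc => hbS (by simp [hc])) a haK hca hab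
        simp [this, hNS]
  · by_cases hNb : N < b
    · have hcol : ∀ r, (r, b) ∉ valueDiagram v := fun r hr =>
        lt_asymm ((mem_valueDiagram.mp hr).1.trans (h.mem_valueDiagram_v.mp hr).2) hNb
      have hcol' : ∀ r, (r, b) ∉ valueDiagram w := fun r hr =>
        (h.mem_valueDiagram_w.mp hr).elim (hcol r) (fun hc => hb hc.2)
      exact iff_of_true ⟨h.inTail_w_iff.mpr (.inr hNb), fun a _ _ _ r _ hr => absurd hr (hcol' r)⟩
        ⟨.inr hNb, ⟨h.inTail_v_of_ge hNb.le, fun a _ _ _ r _ hr => absurd hr (hcol r)⟩,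
          fun h => absurd h hb⟩
    · refine iff_of_false (fun hc => ?_) (fun hc => hc.1.elim hb hNb)
      exact (h.inTail_w_iff.mp hc.1).elim hb hNb

theorem areRecords_iff (h : IsRowRemoval N w v) {y : Equiv.Perm (Fin n)} {B : Finset (Fin n)}
    (hB : B ⊆ rowColumns w N) :
    AreRecords y (rowColumns w N) B ↔
      ∀ b ∈ B, RecordData v y ((rowColumns w N).min' h.nonempty) b := by
  refine forall₂_congr fun b hb => ?_
  have := h.recordData_min_iff (y := y) (hB hb) ((rowColumns w N).min' h.nonempty)
  rw [max_self] at this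
  rw [this]
  exact forall₂_congr fun a ha => ⟨fun h1 _ => h1, fun h1 => h1 (Finset.min'_le _ _ ha)⟩

/-- Row `N` is the lowest, so in a new rectangle it is the lower row. Its lower right vertex is then
a `1` in a column `b` of `B`, and the rectangle is harmless if a `0` above in column `b` forces a
`0` to its left. -/
theorem isRotSet_iff (h : IsRowRemoval N w v) {S : Finset (Fin n × Fin n)}
    (hS : S ⊆ valueDiagram v) {B : Finset (Fin n)} (hB : B ⊆ rowColumns w N) :
    IsRotSet (valueDiagram w) (S ∪ {N} ×ˢ B) ↔ IsRotSet (valueDiagram v) S ∧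
      ∀ b ∈ B, ColumnData v S ((rowColumns w N).min' h.nonempty) b := by
  have hNS := h.notMem_of_subset hS
  have hlt : ∀ {r b}, (r, b) ∈ valueDiagram v → r < N := fun hr =>
    (h.mem_valueDiagram_v.mp hr).2
  have hvw : ∀ {r b}, (r, b) ∈ valueDiagram v → (r, b) ∈ valueDiagram w := fun hr =>
    (h.mem_valueDiagram_v.mp hr).1
  have hmem : ∀ {r b}, r < N → ((r, b) ∈ S ∪ {N} ×ˢ B ↔ (r, b) ∈ S) := fun hr => by
    simp [hr.ne']
  have hmemN : ∀ {b}, ((N, b) ∈ S ∪ {N} ×ˢ B ↔ b ∈ B) := fun {b} => by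
    simp [hNS]
  have hcol : (∀ b ∈ B, ColumnData v S ((rowColumns w N).min' h.nonempty) b) ↔
      ∀ b ∈ B, ∀ a ∈ rowColumns w N, a < b → ∀ r, (r, a) ∈ valueDiagram v →
        (r, b) ∈ valueDiagram v → (r, b) ∉ S → (r, a) ∉ S := by
    refine forall₂_congr fun b hb => ?_
    have := h.columnData_min_iff (S := S) (hB hb) ((rowColumns w N).min' h.nonempty)
    rw [max_self] at this
    rw [this]
    exact forall₂_congr fun a ha => ⟨fun h1 => h1 (Finset.min'_le _ _ ha), fun h1 _ => h1⟩
  rw [hcol]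
  constructor
  · intro hrot
    refine ⟨fun r r' b b' hr hb h1 h2 h3 h4 h5 => ?_, fun b hb a ha hab r hra hrb hbS haS => ?_⟩
    · refine hrot r r' b b' hr hb (hvw h1) (hvw h2) (hvw h3) (hvw h4) ?_
      rwa [hmem (hlt h1), hmem (hlt h1), hmem (hlt h3)]
    · refine hrot r N a b (hlt hra) hab (hvw hra) (hvw hrb)
        (h.mem_valueDiagram_w.mpr (.inr ⟨rfl, ha⟩))
        (h.mem_valueDiagram_w.mpr (.inr ⟨rfl, hB hb⟩)) ?_
      rw [hmem (hlt hra), hmem (hlt hra), hmemN]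
      exact ⟨hbS, haS, hb⟩
  · rintro ⟨hrot, hc⟩ r r' b b' hr hb h1 h2 h3 h4 h5
    have hr' : r' ≤ N := (h.mem_valueDiagram_w.mp h3).elim (fun hx => (hlt hx).le)
      (fun hx => hx.1.le)
    have hrN := hr.trans_le hr'
    have h1' := h.mem_valueDiagram_v.mpr ⟨h1, hrN⟩
    have h2' := h.mem_valueDiagram_v.mpr ⟨h2, hrN⟩
    rw [hmem hrN, hmem hrN] at h5
    rcases hr'.eq_or_lt with rfl | hr'
    · rw [hmemN] at h5
      have hbK : b ∈ rowColumns w r' :=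
        ((h.mem_valueDiagram_w.mp h3).resolve_left fun hx => lt_irrefl _ (hlt hx)).2
      exact hc b' h5.2.2 b hbK hb r h1' h2' h5.1 h5.2.1
    · rw [hmem hr'] at h5
      exact hrot r r' b b' hr hb h1' h2' (h.mem_valueDiagram_v.mpr ⟨h3, hr'⟩)
        (h.mem_valueDiagram_v.mpr ⟨h4, hr'⟩) h5

open scoped Classical in
theorem sum_isRotSet (h : IsRowRemoval N w v) {M : Type*} [AddCommMonoid M]
    (H : Finset (Fin n × Fin n) → M) :
    ∑ S ∈ (valueDiagram w).powerset with IsRotSet (valueDiagram w) S, H S =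
      ∑ S ∈ (valueDiagram v).powerset with IsRotSet (valueDiagram v) S,
        ∑ B ∈ (rowColumns w N).powerset with
          ∀ b ∈ B, ColumnData v S ((rowColumns w N).min' h.nonempty) b,
            H (S ∪ {N} ×ˢ B) := by
  have hsplit : ∀ S ⊆ valueDiagram w,
      S ∩ valueDiagram v ∪ {N} ×ˢ ((rowColumns w N).filter fun b => (N, b) ∈ S) = S := by
    intro S hS
    ext ⟨r, b⟩
    simp only [Finset.mem_union, Finset.mem_inter, Finset.mem_product, Finset.mem_singleton,
      Finset.mem_filter]
    constructor
    · rintro (h1 | ⟨rfl, h1⟩)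
      · exact h1.1
      · exact h1.2
    · intro h1
      rcases h.mem_valueDiagram_w.mp (hS h1) with h2 | ⟨rfl, h2⟩
      · exact .inl ⟨h1, h2⟩
      · exact .inr ⟨rfl, h2, h1⟩
  rw [Finset.sum_sigma']
  refine Finset.sum_bij'
    (fun S _ => ⟨S ∩ valueDiagram v, (rowColumns w N).filter fun b => (N, b) ∈ S⟩)
    (fun p _ => p.1 ∪ {N} ×ˢ p.2) ?_ ?_ ?_ ?_ ?_
  · intro S hS
    rw [Finset.mem_filter, Finset.mem_powerset] at hS
    have := (h.isRotSet_iff Finset.inter_subset_right (Finset.filter_subset _ _)).mp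
      ((hsplit S hS.1).symm ▸ hS.2)
    simp only [Finset.mem_sigma, Finset.mem_filter (p := IsRotSet _), Finset.mem_powerset]
    refine ⟨⟨Finset.inter_subset_right, this.1⟩, ?_⟩
    rw [Finset.mem_filter, Finset.mem_powerset]
    exact ⟨Finset.filter_subset _ _, this.2⟩
  · rintro ⟨S, B⟩ hp
    simp only [Finset.mem_sigma, Finset.mem_filter, Finset.mem_powerset] at hp ⊢
    refine ⟨?_, (h.isRotSet_iff hp.1.1 hp.2.1).mpr ⟨hp.1.2, hp.2.2⟩⟩
    rintro ⟨r, b⟩ hrb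
    simp only [Finset.mem_union, Finset.mem_product, Finset.mem_singleton] at hrb
    exact h.mem_valueDiagram_w.mpr (hrb.imp (fun hx => hp.1.1 hx) fun hx => ⟨hx.1, hp.2.1 hx.2⟩)
  · intro S hS
    rw [Finset.mem_filter, Finset.mem_powerset] at hS
    exact hsplit S hS.1
  · rintro ⟨S, B⟩ hp
    simp only [Finset.mem_sigma, Finset.mem_filter, Finset.mem_powerset] at hp
    have hNS := h.notMem_of_subset hp.1.1
    have hNv : ∀ b, (N, b) ∉ valueDiagram v := h.notMem_of_subset Finset.Subset.rfl
    refine Sigma.ext ?_ (heq_of_eq ?_)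
    · ext ⟨r, b⟩
      simp only [Finset.mem_union, Finset.mem_product, Finset.mem_singleton, Finset.mem_inter]
      constructor
      · rintro ⟨h1 | ⟨rfl, _⟩, h2⟩
        · exact h1
        · exact absurd h2 (hNv b)
      · exact fun h1 => ⟨.inl h1, hp.1.1 h1⟩
    · ext b
      simp only [Finset.mem_filter, Finset.mem_union, Finset.mem_product, Finset.mem_singleton,
        hNS, false_or, true_and]
      exact ⟨fun h1 => h1.2, fun h1 => ⟨hp.2.1 h1, h1⟩⟩
  · intro S hS
    rw [Finset.mem_filter, Finset.mem_powerset] at hS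
    dsimp only
    rw [hsplit S hS.1]

theorem card_union (h : IsRowRemoval N w v) {S : Finset (Fin n × Fin n)}
    (hS : S ⊆ valueDiagram v) (B : Finset (Fin n)) :
    (S ∪ {N} ×ˢ B).card = S.card + B.card := by
  rw [Finset.card_union_of_disjoint, Finset.card_product, Finset.card_singleton, one_mul]
  rw [Finset.disjoint_left]
  rintro ⟨r, b⟩ h1 h2
  rw [Finset.mem_product, Finset.mem_singleton] at h2
  obtain ⟨rfl, -⟩ := h2
  exact h.notMem_of_subset hS b h1

theorem avoids321 (h : IsRowRemoval N w v) (hw : Avoids321 w) : Avoids321 v := by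
  rintro ⟨i, j, k, hij, hjk, h1, h2⟩
  have hi : v i < N := by
    by_contra hcon
    have h3 := h.inv_v (not_lt.mp hcon)
    rw [inv_apply_self] at h3
    rw [← h3] at hcon h2
    rw [h.apply_v j ((not_lt.mp hcon).trans hij.le)] at h2
    exact lt_asymm h2 hij
  have hj := h2.trans hi
  have hk := h1.trans hj
  refine hw ⟨w⁻¹ (v i), w⁻¹ (v j), w⁻¹ (v k), ?_, ?_, ?_, ?_⟩
  · rwa [← h.order _ _ hi hj, inv_apply_self, inv_apply_self]
  · rwa [← h.order _ _ hj hk, inv_apply_self, inv_apply_self]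
  · rwa [apply_inv_self, apply_inv_self]
  · rwa [apply_inv_self, apply_inv_self]

end IsRowRemoval

open scoped Classical in
-- The weight `G` may depend on the data, not only on the degree: the number of ways to add a row
-- depends on the data, so the plain count would not support the induction.
theorem sum_bruhatLE_eq_sum_isRotSet_aux {M : Type} [AddCommMonoid M] (m : ℕ)
    (w : Equiv.Perm (Fin n)) (hw : Avoids321 w) (hm : ∀ j : Fin n, m ≤ j → w j = j)
    (G : ℕ → (Fin n → Fin n → Prop) → M) :
    ∑ u : Equiv.Perm (Fin n) with BruhatLE u w,
        G (length w - length u) (RecordData w (u * w⁻¹)) =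
      ∑ S ∈ (valueDiagram w).powerset with IsRotSet (valueDiagram w) S,
        G S.card (ColumnData w S) := by
  induction m generalizing w G with
  | zero =>
    obtain rfl : w = 1 := Equiv.ext fun j => hm j (Nat.zero_le _)
    have h1 : Finset.univ.filter (fun u : Equiv.Perm (Fin n) => BruhatLE u 1) = {1} := by
      ext u
      rw [Finset.mem_filter, Finset.mem_singleton]
      constructor
      · rintro ⟨-, hu⟩
        exact Equiv.ext fun j => hu.apply_eq_of_forall_ge (N := 0) (fun _ _ => rfl) j (Nat.zero_le _)
      · rintro rfl
        exact ⟨Finset.mem_univ _, .refl⟩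
    have h2 : valueDiagram (1 : Equiv.Perm (Fin n)) = ∅ := by
      refine Finset.eq_empty_of_forall_notMem ?_
      rintro ⟨r, b⟩ hrb
      rw [mem_valueDiagram, inv_one] at hrb
      exact lt_asymm hrb.1 hrb.2
    rw [h1, Finset.sum_singleton, h2, Finset.powerset_empty, Finset.filter_singleton,
      if_pos (by intro _ _ _ _ _ _ h; simp at h), Finset.sum_singleton, Nat.sub_self,
      Finset.card_empty]
    congr 1
    funext c b
    refine propext (and_congr_right fun _ => iff_of_true ?_ ?_)
    · intro a _ _ hab
      simpa using hab
    · intro a _ _ _ r hr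
      simp [h2] at hr
  | succ m ih =>
    by_cases hfix : ∀ j : Fin n, m ≤ j → w j = j
    · exact ih w hw hfix G
    push Not at hfix
    obtain ⟨N, hmN, hN⟩ := hfix
    obtain rfl : m = N := by
      by_contra hne
      exact hN (hm N (by omega))
    have hfix : ∀ j, N < j → w j = j := fun j hj => hm j hj
    -- A descent to the right of `N` among values below `N` completes a `321`; values above `N` are
    -- fixed and cannot start a descent there.
    have hinc : ∀ p q, w⁻¹ N < p → p < q → w p < w q := by
      intro p q hp hpq
      by_contra hcon
      have hqp : w q < w p := lt_of_le_of_ne (not_lt.mp hcon) fun e => hpq.ne' (w.injective e)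
      rcases lt_trichotomy (w p) N with h1 | h1 | h1
      · exact hw ⟨w⁻¹ N, p, q, hp, hpq, hqp, by rwa [apply_inv_self]⟩
      · rw [← h1, inv_apply_self] at hp
        exact lt_irrefl _ hp
      · have h2 := w.injective (hfix _ h1)
        rw [h2] at h1
        rw [h2, hfix q (h1.trans hpq)] at hqp
        exact lt_asymm hpq hqp
    have hne : (rowColumns w N).Nonempty := by
      refine ⟨w N, mem_rowColumns.mpr ?_⟩
      rw [inv_apply_self]
      constructor
      · refine lt_of_le_of_ne ?_ hN
        by_contra hcon
        exact hN (w.injective (hfix _ (not_le.mp hcon)))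
      · refine lt_of_le_of_ne ?_ fun h => hN ?_
        · by_contra hcon
          have := hfix _ (not_le.mp hcon)
          rw [apply_inv_self] at this
          rw [← this] at hcon
          exact hcon le_rfl
        · rw [← h, apply_inv_self, h]
    obtain ⟨v, hv, hord, hsum⟩ := exists_row_removal N w hfix hinc
    have hwv : IsRowRemoval N w v := ⟨hfix, hv, hord, hinc, hne⟩
    rw [hsum fun d z => G d (RecordData w z), hwv.sum_isRotSet]
    -- The sum over all admissible rows `B` is itself a weight in the degree and data of `v`.
    have hIH := ih v (hwv.avoids321 hw) (fun j hj => hv j hj) fun d R =>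
      ∑ B ∈ (rowColumns w N).powerset with ∀ b ∈ B, R ((rowColumns w N).min' hne) b,
        G (d + B.card) (extendData N ((rowColumns w N).min' hne) (rowColumns w N) B R)
    refine Eq.trans ?_ (hIH.trans ?_)
    · refine Finset.sum_congr rfl fun x hx => ?_
      rw [Finset.mem_filter] at hx
      have hy : ∀ j, N ≤ j → (x * v⁻¹) j = j := fun j hj => by
        rw [Equiv.Perm.mul_apply, inv_apply_of_forall_ge hv j hj]
        exact hx.2.apply_eq_of_forall_ge (N := N) hv j hj
      refine Finset.sum_congr (Finset.filter_congr fun B hB => ?_) fun B hB => ?_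
      · exact hwv.areRecords_iff (Finset.mem_powerset.mp hB)
      · rw [Finset.mem_filter, Finset.mem_powerset] at hB
        rw [hwv.recordData_eq hy hB.1 ((hwv.areRecords_iff hB.1).mpr hB.2)]
    · refine Finset.sum_congr rfl fun S hS => ?_
      rw [Finset.mem_filter, Finset.mem_powerset] at hS
      refine Finset.sum_congr rfl fun B _ => ?_
      rw [hwv.card_union hS.1, hwv.columnData_eq hS.1]

open scoped Classical in
theorem sum_bruhatLE_eq_sum_isRotSet {M : Type} [AddCommMonoid M] (w : Equiv.Perm (Fin n))
    (hw : Avoids321 w) (G : ℕ → M) :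
    ∑ u : Equiv.Perm (Fin n) with BruhatLE u w, G (length w - length u) =
      ∑ S ∈ (valueDiagram w).powerset with IsRotSet (valueDiagram w) S, G S.card :=
  sum_bruhatLE_eq_sum_isRotSet_aux n w hw (fun j hj => absurd j.isLt (not_lt.mpr hj))
    fun d _ => G d

end Diagram

/-! ### From sets of cells to fillings, and transposition -/

section GeneratingFunctions

variable {n : ℕ}

theorem mem_seDiagram {w : Equiv.Perm (Fin n)} {i c : Fin n} :
    (i, c) ∈ seDiagram w ↔ c < w i ∧ i < w⁻¹ c := by
  simp only [seDiagram, Finset.mem_filter, Finset.mem_univ, true_and]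
  constructor
  · rintro ⟨j, h1, h2, rfl⟩
    exact ⟨h2, by rwa [inv_apply_self]⟩
  · rintro ⟨h1, h2⟩
    exact ⟨w⁻¹ c, h2, by rwa [apply_inv_self], by rw [apply_inv_self]⟩

theorem mem_seDiagram_iff_valueDiagram {w : Equiv.Perm (Fin n)} {i c : Fin n} :
    (i, c) ∈ seDiagram w ↔ (w i, c) ∈ valueDiagram w := by
  rw [mem_seDiagram, mem_valueDiagram, inv_apply_self]

theorem mem_seDiagram_inv {w : Equiv.Perm (Fin n)} {i c : Fin n} :
    (c, i) ∈ seDiagram w⁻¹ ↔ (i, c) ∈ seDiagram w := by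
  rw [mem_seDiagram, mem_seDiagram, inv_inv, and_comm]

/-- Two rows meeting column `c` out of order would form a `321` with the position of the value `c`.
Hence renaming rows by `w` preserves the vertical order within every rectangle of the diagram. -/
theorem Avoids321.apply_lt_apply_iff {w : Equiv.Perm (Fin n)} (hw : Avoids321 w)
    {i i' c : Fin n} (h : (i, c) ∈ seDiagram w) (h' : (i', c) ∈ seDiagram w) :
    w i < w i' ↔ i < i' := by
  rw [mem_seDiagram] at h h'
  have key : ∀ {a b : Fin n}, c < w b → b < w⁻¹ c → a < b → ¬ w b < w a := by
    intro a b h1 h2 hab hlt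
    exact hw ⟨a, b, w⁻¹ c, hab, h2, by rwa [apply_inv_self], hlt⟩
  rcases lt_trichotomy i i' with h1 | rfl | h1
  · refine iff_of_true (lt_of_le_of_ne (not_lt.mp (key h'.1 h'.2 h1)) ?_) h1
    exact fun e => h1.ne (w.injective e)
  · simp
  · exact iff_of_false (key h.1 h.2 h1) h1.asymm

/-- The cells of a filling with entry `1`, rows being renamed by `w`. -/
def onesSet (w : Equiv.Perm (Fin n)) (f : Filling (seDiagram w)) : Finset (Fin n × Fin n) :=
  (Finset.univ.filter fun c => f c = 1).image fun c => (w c.1.1, c.1.2)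

theorem mem_onesSet {w : Equiv.Perm (Fin n)} {f : Filling (seDiagram w)} {i c : Fin n}
    (h : (i, c) ∈ seDiagram w) : (w i, c) ∈ onesSet w f ↔ f ⟨(i, c), h⟩ = 1 := by
  simp only [onesSet, Finset.mem_image, Finset.mem_filter, Finset.mem_univ, true_and,
    Prod.mk.injEq, w.injective.eq_iff]
  constructor
  · rintro ⟨⟨⟨i', c'⟩, h'⟩, h1, rfl, rfl⟩
    exact h1
  · exact fun h1 => ⟨⟨(i, c), h⟩, h1, rfl, rfl⟩

theorem onesSet_subset (w : Equiv.Perm (Fin n)) (f : Filling (seDiagram w)) :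
    onesSet w f ⊆ valueDiagram w := by
  intro p hp
  simp only [onesSet, Finset.mem_image] at hp
  obtain ⟨⟨⟨i, c⟩, h⟩, -, rfl⟩ := hp
  exact mem_seDiagram_iff_valueDiagram.mp h

theorem card_onesSet (w : Equiv.Perm (Fin n)) (f : Filling (seDiagram w)) :
    (onesSet w f).card = f.size := by
  refine Finset.card_image_of_injective _ ?_
  rintro ⟨⟨i, c⟩, h⟩ ⟨⟨i', c'⟩, h'⟩ heq
  simpa using heq

theorem Avoids321.isRotSet_onesSet {w : Equiv.Perm (Fin n)} (hw : Avoids321 w)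
    (f : Filling (seDiagram w)) : IsRotSet (valueDiagram w) (onesSet w f) ↔ f.IsRotL := by
  have hzero : ∀ c, f c = 0 ↔ ¬ f c = 1 := fun c => by
    generalize f c = x
    revert x
    decide
  constructor
  · intro h i i' j j' hi hj h1 h2 h3 h4
    have := h (w i) (w i') j j' ((hw.apply_lt_apply_iff h1 h3).mpr hi) hj
      (mem_seDiagram_iff_valueDiagram.mp h1) (mem_seDiagram_iff_valueDiagram.mp h2)
      (mem_seDiagram_iff_valueDiagram.mp h3) (mem_seDiagram_iff_valueDiagram.mp h4)
    rwa [mem_onesSet h1, mem_onesSet h2, mem_onesSet h4, ← hzero] at this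
  · intro h r r' b b' hr hb h1 h2 h3 h4
    obtain ⟨i, rfl⟩ := w.surjective r
    obtain ⟨i', rfl⟩ := w.surjective r'
    rw [← mem_seDiagram_iff_valueDiagram] at h1 h2 h3 h4
    rw [mem_onesSet h1, mem_onesSet h2, mem_onesSet h4, ← hzero]
    exact h i i' b b' ((hw.apply_lt_apply_iff h1 h3).mp hr) hb h1 h2 h3 h4

open scoped Classical in
theorem Avoids321.genRotL_eq_sum_isRotSet {w : Equiv.Perm (Fin n)} (hw : Avoids321 w) :
    genRotL w =
      ∑ S ∈ (valueDiagram w).powerset with IsRotSet (valueDiagram w) S, (X : ℤ[X]) ^ S.card := by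
  refine Finset.sum_bij (fun f _ => onesSet w f) ?_ ?_ ?_ ?_
  · intro f hf
    rw [Finset.mem_filter] at hf ⊢
    exact ⟨Finset.mem_powerset.mpr (onesSet_subset w f), (hw.isRotSet_onesSet f).mpr hf.2⟩
  · intro f _ g _ hfg
    funext ⟨⟨i, c⟩, h⟩
    have h1 := mem_onesSet (f := f) h
    rw [hfg, mem_onesSet h] at h1
    generalize f ⟨(i, c), h⟩ = x at h1 ⊢
    generalize g ⟨(i, c), h⟩ = y at h1 ⊢
    revert x y
    decide
  · intro S hS
    rw [Finset.mem_filter, Finset.mem_powerset] at hS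
    let f : Filling (seDiagram w) := fun c => if (w c.1.1, c.1.2) ∈ S then 1 else 0
    have hf : onesSet w f = S := by
      ext ⟨r, c⟩
      obtain ⟨i, rfl⟩ := w.surjective r
      by_cases hi : (i, c) ∈ seDiagram w
      · rw [mem_onesSet hi]
        by_cases hc : (w i, c) ∈ S <;> simp [f, hc]
      · rw [mem_seDiagram_iff_valueDiagram] at hi
        exact iff_of_false (fun hc => hi (onesSet_subset w f hc)) fun hc => hi (hS.1 hc)
    refine ⟨f, ?_, hf⟩
    rw [Finset.mem_filter, ← hw.isRotSet_onesSet, hf]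
    exact ⟨Finset.mem_univ _, hS.2⟩
  · intro f _
    rw [card_onesSet]

theorem Avoids321.toLaurent_genRotL {w : Equiv.Perm (Fin n)} (hw : Avoids321 w) :
    toLaurent (genRotL w) = reversedPoincare w := by
  classical
  rw [hw.genRotL_eq_sum_isRotSet,
    ← sum_bruhatLE_eq_sum_isRotSet w hw fun d => (X : ℤ[X]) ^ d, reversedPoincare, poincare,
    map_sum, map_sum, map_sum, Finset.mul_sum]
  refine Finset.sum_congr (by congr) fun u hu => ?_
  rw [Finset.mem_filter] at hu
  rw [toLaurent_X_pow, toLaurent_X_pow, invert_T, ← T_add, Nat.cast_sub hu.2.length_le,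
    sub_eq_add_neg]

theorem length_inv (w : Equiv.Perm (Fin n)) : length w⁻¹ = length w := by
  rw [length_eq_card_inversions, length_eq_card_inversions]
  refine Finset.card_bij' (fun p _ => (w⁻¹ p.2, w⁻¹ p.1)) (fun p _ => (w p.2, w p.1)) ?_ ?_ ?_ ?_
  · rintro ⟨a, b⟩ h
    rw [mem_inversions] at h ⊢
    rw [apply_inv_self, apply_inv_self]
    exact h.symm
  · rintro ⟨a, b⟩ h
    rw [mem_inversions] at h ⊢
    rw [inv_apply_self, inv_apply_self]
    exact h.symm
  · rintro ⟨a, b⟩ _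
    simp
  · rintro ⟨a, b⟩ _
    simp

/-- Inverting turns right multiplication by a transposition into left multiplication, which
conjugation by `a` turns back into right multiplication by `swap (a i) (a j)`. -/
theorem BruhatLE.inv {u v : Equiv.Perm (Fin n)} (h : BruhatLE u v) : BruhatLE u⁻¹ v⁻¹ := by
  refine Relation.ReflTransGen.lift (fun x : Equiv.Perm (Fin n) => x⁻¹) ?_ _ _ h
  rintro a b ⟨i, j, hij, rfl, hl⟩
  refine ⟨a i, a j, fun e => hij (a.injective e), ?_, ?_⟩
  · beta_reduce
    rw [mul_inv_rev, Equiv.swap_inv, Equiv.swap_mul_eq_mul_swap, inv_inv]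
  · rw [length_inv, length_inv, hl]

theorem bruhatLE_inv_iff {u v : Equiv.Perm (Fin n)} : BruhatLE u⁻¹ v⁻¹ ↔ BruhatLE u v :=
  ⟨fun h => by simpa only [inv_inv] using h.inv, fun h => h.inv⟩

theorem reversedPoincare_inv (w : Equiv.Perm (Fin n)) :
    reversedPoincare w⁻¹ = reversedPoincare w := by
  classical
  have h : poincare w⁻¹ = poincare w := by
    rw [poincare, poincare, Finset.sum_filter, Finset.sum_filter,
      ← Equiv.sum_comp (Equiv.inv (Equiv.Perm (Fin n)))]
    refine Finset.sum_congr rfl fun u _ => ?_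
    simp only [Equiv.inv_apply, length_inv, bruhatLE_inv_iff]
  rw [reversedPoincare, reversedPoincare, h, length_inv]

theorem Avoids321.inv {w : Equiv.Perm (Fin n)} (hw : Avoids321 w) : Avoids321 w⁻¹ := by
  rintro ⟨i, j, k, hij, hjk, h1, h2⟩
  exact hw ⟨w⁻¹ k, w⁻¹ j, w⁻¹ i, h1, h2, by rwa [apply_inv_self, apply_inv_self],
    by rwa [apply_inv_self, apply_inv_self]⟩

/-- Transposition of cells. -/
def transposeCells (w : Equiv.Perm (Fin n)) : seDiagram w ≃ seDiagram w⁻¹ :=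
  (Equiv.prodComm (Fin n) (Fin n)).subtypeEquiv fun _ => mem_seDiagram_inv.symm

/-- Transposition exchanges the lower left and upper right vertices of a rectangle and keeps the
other two in place. -/
theorem genL_eq_genRotL_inv (w : Equiv.Perm (Fin n)) : genL w = genRotL w⁻¹ := by
  classical
  refine Finset.sum_equiv ((transposeCells w).arrowCongr (Equiv.refl (Fin 2))) ?_ ?_
  · intro f
    simp only [Finset.mem_filter, Finset.mem_univ, true_and]
    constructor
    · intro h i i' j j' hi hj h1 h2 h3 h4 hf
      exact h j j' i i' hj hi (mem_seDiagram_inv.mp h1) (mem_seDiagram_inv.mp h3)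
        (mem_seDiagram_inv.mp h2) (mem_seDiagram_inv.mp h4) hf
    · intro h i i' j j' hi hj h1 h2 h3 h4 hf
      exact h j j' i i' hj hi (mem_seDiagram_inv.mpr h1) (mem_seDiagram_inv.mpr h3)
        (mem_seDiagram_inv.mpr h2) (mem_seDiagram_inv.mpr h4) hf
  · intro f _
    congr 1
    refine Finset.card_equiv (transposeCells w) fun c => ?_
    simp [Equiv.arrowCongr_apply]

end GeneratingFunctions

end PermDiagram

theorem mainTheorem7 (n : ℕ) (w : Equiv.Perm (Fin n)) (hw : PermDiagram.Avoids321 w) :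
    Polynomial.toLaurent (PermDiagram.genL w) = PermDiagram.reversedPoincare w ∧
      Polynomial.toLaurent (PermDiagram.genRotL w) = PermDiagram.reversedPoincare w := by
  refine ⟨?_, hw.toLaurent_genRotL⟩
  rw [PermDiagram.genL_eq_genRotL_inv, hw.inv.toLaurent_genRotL, PermDiagram.reversedPoincare_inv]
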